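/- For an integer $d\ge 1$ and $r\in\mathbb{R}$ let $G_d(x,0)$ be the cumulative distribution function of the central chi-squared distribution with $d$ degrees of freedom (the law of $\sum_{i=1}^d Z_i^2$ with $Z_1,\dots,Z_d$ i.i.d. $N(0,1)$), and let $G_d(x,r^2)$ be that of the noncentral chi-squared distribution with $d$ degrees of freedom and noncentrality parameter $r^2$ (the law of $\sum_{i=1}^d (Z_i+m_i)^2$ for any $m\in\mathbb{R}^d$ with $\sum_i m_i^2=r^2$). Let $\Phi$ be the standard normal distribution function. For $\alpha\in(0,1)$ let $T_{d\alpha}$ and $z_\alpha$ be the $(1-\alpha)$-quantiles of the central chi-squared distribution with $d$ degrees of freedom and of $N(0,1)$, respectively. Then, as $d\to\infty$: 1. $$\sup_{x\in\mathbb{R}}\left|G_d(x,0)-\Phi\left(\frac{x-d}{\sqrt{2d}}\right)\right|\to 0;$$ 2. $$\sup_{x,r\in\mathbb{R}}\left|G_d(x,r^2)-\Phi\left(\frac{x-d-r^2}{\sqrt{2d+4r^2}}\right)\right|\to 0;$$ 3. for every fixed $\alpha\in(0,1)$, $$\sup_{r\in\mathbb{R}}\left|G_d(T_{d\alpha},r^2)-\Phi\left(\frac{\sqrt{2d}}{\sqrt{2d+4r^2}}\,z_\alpha-\frac{r^2}{\sqrt{2d+4r^2}}\right)\right|\to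 0.$$ -/

import Mathlib

open MeasureTheory ProbabilityTheory Filter Topology

/-- The law of `d` independent standard normal variables. -/
noncomputable def stdNormalVec (d : ℕ) : Measure (Fin d → ℝ) :=
  Measure.pi fun _ => gaussianReal 0 1

/-- The central chi-squared distribution with `d` degrees of freedom: the law of
`∑ i, Z i ^ 2` for independent standard normal variables `Z i`, `i < d`. -/
noncomputable def centralChiSq (d : ℕ) : Measure ℝ :=
  (stdNormalVec d).map fun z => ∑ i, z i ^ 2

/-- The noncentral chi-squared distribution with `d ≥ 1` degrees of freedom and noncentrality
parameter `lam ≥ 0`: the law of `∑ i, (Z i + m i) ^ 2`, where the `Z i` are independent standard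
normal and `∑ i, m i ^ 2 = lam`. The law depends on the shift `m` through `lam` only, see
`noncentralChiSq_eq_map`; here every coordinate is shifted by the same amount `√(lam / d)`. -/
noncomputable def noncentralChiSq (d : ℕ) (lam : ℝ) : Measure ℝ :=
  (stdNormalVec d).map fun z => ∑ i, (z i + √(lam / d)) ^ 2

/-- The standard normal distribution function. -/
noncomputable def stdNormalCDF (x : ℝ) : ℝ := cdf (gaussianReal 0 1) x

/-- The `p`-quantile of a probability measure on the line, `0 < p < 1`: the least `x` with
`p ≤ F x`, where `F` is the distribution function (see `isLeast_quantile`). -/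
noncomputable def quantile (P : Measure ℝ) (p : ℝ) : ℝ := sInf {x : ℝ | p ≤ cdf P x}

/-! ### The definitions are meaningful -/

instance (d : ℕ) : IsProbabilityMeasure (stdNormalVec d) := by
  unfold stdNormalVec; infer_instance

instance (d : ℕ) : IsProbabilityMeasure (centralChiSq d) :=
  Measure.isProbabilityMeasure_map (Measurable.aemeasurable (by fun_prop))

instance (d : ℕ) (lam : ℝ) : IsProbabilityMeasure (noncentralChiSq d lam) :=
  Measure.isProbabilityMeasure_map (Measurable.aemeasurable (by fun_prop))

theorem noncentralChiSq_zero (d : ℕ) : noncentralChiSq d 0 = centralChiSq d := by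
  simp [noncentralChiSq, centralChiSq]

/-- Shifts of equal Euclidean norm give the same law. -/
theorem map_shift_eq_of_sum_sq_eq (d : ℕ) (m m' : Fin d → ℝ)
    (h : ∑ i, m i ^ 2 = ∑ i, m' i ^ 2) :
    ((stdNormalVec d).map fun z => ∑ i, (z i + m i) ^ 2) =
      (stdNormalVec d).map fun z => ∑ i, (z i + m' i) ^ 2 := by
  have key : ∀ a : Fin d → ℝ, ((stdNormalVec d).map fun z => ∑ i, (z i + a i) ^ 2) =
      (stdGaussian (EuclideanSpace ℝ (Fin d))).map fun w => ‖w + WithLp.toLp 2 a‖ ^ 2 := by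
    intro a
    rw [← map_pi_eq_stdGaussian, Measure.map_map (by fun_prop) (by fun_prop)]
    congr 1
    funext z
    simp [EuclideanSpace.norm_sq_eq]
  have hn : ‖(WithLp.toLp 2 m : EuclideanSpace ℝ (Fin d))‖ =
      ‖(WithLp.toLp 2 m' : EuclideanSpace ℝ (Fin d))‖ := by
    simp [EuclideanSpace.norm_eq, h]
  rw [key, key]
  set v : EuclideanSpace ℝ (Fin d) := WithLp.toLp 2 m
  set w : EuclideanSpace ℝ (Fin d) := WithLp.toLp 2 m'
  have hU := Submodule.reflection_sub hn
  set U := (Submodule.span ℝ {v - w})ᗮ.reflection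
  conv_rhs => rw [← stdGaussian_map U]
  rw [Measure.map_map (by fun_prop) U.continuous.measurable]
  congr 1
  funext z
  simp only [Function.comp]
  rw [← hU, ← map_add, LinearIsometryEquiv.norm_map]

/-- Any shift `m` with `∑ i, m i ^ 2 = lam` may be used for the noncentral chi-squared law. -/
theorem noncentralChiSq_eq_map (d : ℕ) (lam : ℝ) (hd : 0 < d) (m : Fin d → ℝ)
    (hm : ∑ i, m i ^ 2 = lam) :
    noncentralChiSq d lam = (stdNormalVec d).map fun z => ∑ i, (z i + m i) ^ 2 := by
  refine map_shift_eq_of_sum_sq_eq d (fun _ => √(lam / d)) m ?_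
  have h0 : 0 ≤ lam := hm ▸ Finset.sum_nonneg fun i _ => sq_nonneg (m i)
  have hd' : (d : ℝ) ≠ 0 := by positivity
  rw [hm]
  simp only [Finset.sum_const, Finset.card_univ, Fintype.card_fin, nsmul_eq_mul]
  rw [Real.sq_sqrt (by positivity)]
  field_simp

theorem isLeast_quantile (P : Measure ℝ) (p : ℝ) (h0 : 0 < p) (h1 : p < 1) :
    IsLeast {x : ℝ | p ≤ cdf P x} (quantile P p) := by
  have hne : {x : ℝ | p ≤ cdf P x}.Nonempty :=
    (((tendsto_cdf_atTop P).eventually (lt_mem_nhds h1)).exists).imp fun _ h => le_of_lt h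
  obtain ⟨b, hb⟩ := ((tendsto_cdf_atBot P).eventually (gt_mem_nhds h0)).exists
  have hbdd : BddBelow {x : ℝ | p ≤ cdf P x} := by
    refine ⟨b, fun x hx => ?_⟩
    by_contra hlt
    have := monotone_cdf P (le_of_lt (not_le.mp hlt))
    have hx' : p ≤ cdf P x := hx
    linarith
  refine ⟨?_, fun x hx => csInf_le hbdd hx⟩
  have hright : Tendsto (cdf P) (𝓝[>] (quantile P p)) (𝓝 (cdf P (quantile P p))) :=
    ((cdf P).right_continuous _).tendsto.mono_left (nhdsWithin_mono _ Set.Ioi_subset_Ici_self)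
  refine ge_of_tendsto hright ?_
  filter_upwards [self_mem_nhdsWithin] with y hy
  obtain ⟨x, hx, hxy⟩ := exists_lt_of_csInf_lt hne hy
  exact le_trans hx (monotone_cdf P hxy.le)

/-!
The characteristic function of the noncentral chi-squared law with `d` degrees of freedom and
noncentrality parameter `λ` is explicit: `exp (i λ t / (1 - 2 i t)) * (1 - 2 i t) ^ (-d / 2)`. With
`σ ^ 2 = 2 d + 4 λ`, the second-order expansion of its exponent at `t / σ` gives, after centering at
the mean `d + λ`, the value `-t ^ 2 / 2` up to an error of at most `2 |t| ^ 3 / σ`. Hence the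
standardized law converges to `N(0, 1)` along every family of parameters with `σ → ∞`. Uniformity
in `r` is the case of a family indexed by all pairs `(d, r)`, along the filter `atTop ×ˢ ⊤`, and
uniformity in `x` comes from Pólya's theorem. Quantiles converge as well, because the limiting
distribution function is strictly increasing; the third claim then follows from the second by
uniform continuity of the normal distribution function.
-/

/-! ### Distribution functions and quantiles -/

section DistributionFunction

variable {ι : Type*} {l : Filter ι}

theorem tendsto_comp_sub_comp {α β : Type*} [AddGroup α] [UniformSpace α] [IsUniformAddGroup α]
    [AddGroup β] [UniformSpace β] [IsUniformAddGroup β] {f : α → β} (hf : UniformContinuous f)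
    {u v : ι → α} (h : Tendsto (fun i => u i - v i) l (𝓝 0)) :
    Tendsto (fun i => f (u i) - f (v i)) l (𝓝 0) := by
  rw [UniformContinuous, uniformity_eq_comap_nhds_zero, uniformity_eq_comap_nhds_zero,
    tendsto_comap_iff] at hf
  exact hf.comp (show Tendsto (fun i => (v i, u i)) l _ from tendsto_comap_iff.2 h)

theorem tendsto_of_tendsto_charFun {E : Type*} [NormedAddCommGroup E] [InnerProductSpace ℝ E]
    [FiniteDimensional ℝ E] [MeasurableSpace E] [BorelSpace E] [l.IsCountablyGenerated]
    {μ : ι → ProbabilityMeasure E} {μ₀ : ProbabilityMeasure E}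
    (h : ∀ t, Tendsto (fun i => charFun (μ i) t) l (𝓝 (charFun (μ₀ : Measure E) t))) :
    Tendsto μ l (𝓝 μ₀) :=
  tendsto_of_seq_tendsto fun _ hu =>
    ProbabilityMeasure.tendsto_of_tendsto_charFun fun t => (h t).comp hu

theorem tendsto_cdf_of_tendsto {μ : ι → ProbabilityMeasure ℝ} {μ₀ : ProbabilityMeasure ℝ}
    [hμ₀ : NullSingletonClass (μ₀ : Measure ℝ)] (h : Tendsto μ l (𝓝 μ₀)) (x : ℝ) :
    Tendsto (fun i => cdf (μ i) x) l (𝓝 (cdf μ₀ x)) := by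
  have := ProbabilityMeasure.tendsto_measure_of_null_frontier_of_tendsto' h
    (E := Set.Iic x) (by rw [frontier_Iic]; exact measure_singleton x)
  simp_rw [cdf_eq_real]
  exact (ENNReal.tendsto_toReal (measure_ne_top _ _)).comp this

theorem tendsto_cdf_of_tendsto_charFun [l.IsCountablyGenerated] {P : ι → Measure ℝ}
    {Q : Measure ℝ} [∀ i, IsProbabilityMeasure (P i)] [IsProbabilityMeasure Q]
    [hQ : NullSingletonClass Q]
    (h : ∀ t, Tendsto (fun i => charFun (P i) t) l (𝓝 (charFun Q t))) (x : ℝ) :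
    Tendsto (fun i => cdf (P i) x) l (𝓝 (cdf Q x)) :=
  tendsto_cdf_of_tendsto (μ := fun i => ⟨P i, inferInstance⟩) (μ₀ := ⟨Q, inferInstance⟩)
    (hμ₀ := hQ) (tendsto_of_tendsto_charFun h) x

theorem continuous_cdf (P : Measure ℝ) [IsProbabilityMeasure P] [NullSingletonClass P] :
    Continuous (cdf P) := by
  refine continuous_iff_continuousAt.2 fun x => ?_
  have hjump : ENNReal.ofReal (cdf P x - Function.leftLim (cdf P) x) = 0 := by
    rw [← StieltjesFunction.measure_singleton, measure_cdf, measure_singleton]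
  have hle : cdf P x ≤ Function.leftLim (cdf P) x :=
    sub_nonpos.1 (ENNReal.ofReal_eq_zero.1 hjump)
  refine (monotone_cdf P).continuousAt_iff_leftLim_eq_rightLim.2 ?_
  rw [StieltjesFunction.rightLim_eq]
  exact ((monotone_cdf P).leftLim_le le_rfl).antisymm hle

theorem strictMono_cdf (P : Measure ℝ) [IsProbabilityMeasure P] [P.IsOpenPosMeasure] :
    StrictMono (cdf P) := by
  intro x y hxy
  have hpos : 0 < P (Set.Ioc x y) :=
    (isOpen_Ioo.measure_pos P (Set.nonempty_Ioo.2 hxy)).trans_le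
      (measure_mono Set.Ioo_subset_Ioc_self)
  rw [← measure_cdf P, StieltjesFunction.measure_Ioc, ENNReal.ofReal_pos] at hpos
  exact sub_pos.1 hpos

/-- Pólya's theorem. Along an ultrafilter of pairs `(i, x)` the values `G x` converge to some `p`,
and comparison with points `y` where `G y` is slightly smaller or larger than `p` forces `F i x`
to converge to `p` too. -/
theorem tendstoUniformly_of_monotone {α : Type*} [LinearOrder α] [TopologicalSpace α]
    [PreconnectedSpace α] [Nonempty α] {F : ι → α → ℝ} {G : α → ℝ} {a b : ℝ}
    (hF_mono : ∀ i, Monotone (F i)) (hF_mem : ∀ i x, F i x ∈ Set.Icc a b)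
    (hG_mono : Monotone G) (hG_cont : Continuous G) (hG_bot : Tendsto G atBot (𝓝 a))
    (hG_top : Tendsto G atTop (𝓝 b)) (h : ∀ x, Tendsto (fun i => F i x) l (𝓝 (G x))) :
    TendstoUniformly F G l := by
  have hG_mem (x : α) : G x ∈ Set.Icc a b :=
    ⟨hG_mono.le_of_tendsto hG_bot x, hG_mono.ge_of_tendsto hG_top x⟩
  have hG_range : Set.Ioo a b ⊆ Set.range G := by
    rw [← Set.image_univ]
    exact isPreconnected_univ.intermediate_value_Ioo (by simp) (by simp)
      hG_cont.continuousOn hG_bot hG_top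
  rw [tendstoUniformly_iff_tendsto, tendsto_iff_ultrafilter]
  intro U hU
  have hU_fst : Tendsto (fun q : ι × α => q.1) U l := tendsto_fst.mono_left hU
  obtain ⟨p, hp_mem, hp⟩ := isCompact_Icc.ultrafilter_le_nhds (U.map fun q : ι × α => G q.2)
    (tendsto_principal.2 (Eventually.of_forall fun q => hG_mem q.2))
  have hGp : Tendsto (fun q : ι × α => G q.2) U (𝓝 p) := hp
  have hFp : Tendsto (fun q : ι × α => F q.1 q.2) U (𝓝 p) := by
    refine tendsto_order.2 ⟨fun c hc => ?_, fun c hc => ?_⟩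
    · rcases lt_or_ge c a with hca | hac
      · exact Eventually.of_forall fun q => hca.trans_le (hF_mem _ _).1
      obtain ⟨c', hcc', hc'p⟩ := exists_between hc
      obtain ⟨y, rfl⟩ := hG_range ⟨hac.trans_lt hcc', hc'p.trans_le hp_mem.2⟩
      filter_upwards [((h y).comp hU_fst).eventually_const_lt hcc', hGp.eventually_const_lt hc'p]
        with q hFq hGq
      exact hFq.trans_le (hF_mono _ (hG_mono.reflect_lt hGq).le)
    · rcases lt_or_ge b c with hbc | hcb
      · exact Eventually.of_forall fun q => (hF_mem _ _).2.trans_lt hbc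
      obtain ⟨c', hpc', hc'c⟩ := exists_between hc
      obtain ⟨y, rfl⟩ := hG_range ⟨hp_mem.1.trans_lt hpc', hc'c.trans_le hcb⟩
      filter_upwards [((h y).comp hU_fst).eventually_lt_const hc'c, hGp.eventually_lt_const hpc']
        with q hFq hGq
      exact (hF_mono _ (hG_mono.reflect_lt hGq).le).trans_lt hFq
  exact (hGp.prodMk_nhds hFp).mono_right (nhds_le_uniformity p)

theorem tendstoUniformly_cdf {P : ι → Measure ℝ} {Q : Measure ℝ} [IsProbabilityMeasure Q]
    [NullSingletonClass Q] (h : ∀ x, Tendsto (fun i => cdf (P i) x) l (𝓝 (cdf Q x))) :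
    TendstoUniformly (fun i => cdf (P i)) (cdf Q) l :=
  tendstoUniformly_of_monotone (fun i => monotone_cdf (P i))
    (fun i x => ⟨cdf_nonneg (P i) x, cdf_le_one (P i) x⟩) (monotone_cdf Q) (continuous_cdf Q)
    (tendsto_cdf_atBot Q) (tendsto_cdf_atTop Q) h

theorem uniformContinuous_cdf (P : Measure ℝ) [IsProbabilityMeasure P] [NullSingletonClass P] :
    UniformContinuous (cdf P) := by
  have htranslate : TendstoUniformly (fun δ x => cdf P (x + δ)) (cdf P) (𝓝 0) :=
    tendstoUniformly_of_monotone (fun δ _ _ h => monotone_cdf P (by gcongr))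
      (fun δ x => ⟨cdf_nonneg P _, cdf_le_one P _⟩) (monotone_cdf P) (continuous_cdf P)
      (tendsto_cdf_atBot P) (tendsto_cdf_atTop P) fun x => by
        simpa [Function.comp_def] using ((continuous_cdf P).comp (continuous_const_add x)).tendsto 0
  have hsub : Tendsto (fun q : ℝ × ℝ => (q.2 - q.1, q.1)) (uniformity ℝ) (𝓝 0 ×ˢ ⊤) := by
    rw [uniformity_eq_comap_nhds_zero]
    exact tendsto_comap.prodMk tendsto_top
  simpa [UniformContinuous, Function.comp_def] using
    (tendstoUniformly_iff_tendsto.1 htranslate).comp hsub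

end DistributionFunction

section Quantile

variable {p : ℝ}

theorem quantile_le_iff {P : Measure ℝ} (h0 : 0 < p) (h1 : p < 1) {x : ℝ} :
    quantile P p ≤ x ↔ p ≤ cdf P x :=
  ⟨fun h => (isLeast_quantile P p h0 h1).1.trans (monotone_cdf P h),
    fun h => (isLeast_quantile P p h0 h1).2 h⟩

theorem cdf_map_orderIso (P : Measure ℝ) [IsProbabilityMeasure P] (e : ℝ ≃o ℝ) (x : ℝ) :
    cdf (P.map e) (e x) = cdf P x := by
  have := Measure.isProbabilityMeasure_map (μ := P) e.monotone.measurable.aemeasurable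
  rw [cdf_eq_real, cdf_eq_real, map_measureReal_apply e.monotone.measurable measurableSet_Iic,
    e.preimage_Iic, e.symm_apply_apply]

theorem quantile_map_orderIso (P : Measure ℝ) [IsProbabilityMeasure P] (e : ℝ ≃o ℝ)
    (h0 : 0 < p) (h1 : p < 1) : quantile (P.map e) p = e (quantile P p) := by
  refine eq_of_forall_ge_iff fun x => ?_
  obtain ⟨y, rfl⟩ := e.surjective x
  rw [quantile_le_iff h0 h1, cdf_map_orderIso, e.le_iff_le, quantile_le_iff h0 h1]

theorem cdf_map_sub_div (P : Measure ℝ) [IsProbabilityMeasure P] (c : ℝ) {s : ℝ} (hs : 0 < s)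
    (x : ℝ) : cdf (P.map fun x => (x - c) / s) ((x - c) / s) = cdf P x :=
  cdf_map_orderIso P ((OrderIso.subRight c).trans (OrderIso.divRight₀ s hs)) x

theorem quantile_map_sub_div (P : Measure ℝ) [IsProbabilityMeasure P] (c : ℝ) {s : ℝ} (hs : 0 < s)
    (h0 : 0 < p) (h1 : p < 1) :
    quantile (P.map fun x => (x - c) / s) p = (quantile P p - c) / s :=
  quantile_map_orderIso P ((OrderIso.subRight c).trans (OrderIso.divRight₀ s hs)) h0 h1

theorem tendsto_quantile {ι : Type*} {l : Filter ι} {P : ι → Measure ℝ} {Q : Measure ℝ}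
    (hQ : StrictMono (cdf Q)) (h : ∀ x, Tendsto (fun i => cdf (P i) x) l (𝓝 (cdf Q x)))
    (h0 : 0 < p) (h1 : p < 1) : Tendsto (fun i => quantile (P i) p) l (𝓝 (quantile Q p)) := by
  refine tendsto_order.2 ⟨fun x hx => ?_, fun x hx => ?_⟩
  · have hlt : cdf Q x < p := by
      rwa [← not_le, ← quantile_le_iff h0 h1, not_le]
    filter_upwards [(h x).eventually_lt_const hlt] with i hi
    rwa [← not_le, quantile_le_iff h0 h1, not_le]
  · obtain ⟨y, hy, hyx⟩ := exists_between hx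
    have hlt : p < cdf Q y := ((quantile_le_iff h0 h1).1 le_rfl).trans_lt (hQ hy)
    filter_upwards [(h y).eventually_const_lt hlt] with i hi
    exact ((quantile_le_iff h0 h1).2 hi.le).trans_lt hyx

end Quantile

/-! ### The characteristic function of the noncentral chi-squared law -/

section CharacteristicFunction

open Complex Real

lemma inv_sqrt_mul_cpow_one_half {c : ℝ} (hc : 0 < c) {w : ℂ} (hw : w ∈ slitPlane) :
    (√c)⁻¹ * (c * w⁻¹) ^ (1 / 2 : ℂ) = cexp (-(1 / 2 * log w)) := by
  have hw₀ : w⁻¹ ≠ 0 := inv_ne_zero (slitPlane_ne_zero hw)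
  have hsqrt : (√c : ℂ) = cexp (1 / 2 * Real.log c) := by
    rw [sqrt_eq_rpow, rpow_def_of_pos hc, ofReal_exp]
    push_cast
    ring_nf
  rw [cpow_def_of_ne_zero (mul_ne_zero (ofReal_ne_zero.2 hc.ne') hw₀), log_ofReal_mul hc hw₀,
    log_inv _ (slitPlane_arg_ne_pi hw), ofReal_inv, hsqrt, ← Complex.exp_neg, ← Complex.exp_add]
  ring_nf

lemma norm_log_one_add_sub_le {w : ℂ} (hw : ‖w‖ ≤ 1 / 2) :
    ‖log (1 + w) - (w - w ^ 2 / 2)‖ ≤ ‖w‖ ^ 3 := by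
  have htaylor : logTaylor 3 w = w - w ^ 2 / 2 := by
    simp only [logTaylor_succ, logTaylor_zero, Pi.add_apply]
    push_cast
    ring
  have hinv : (1 - ‖w‖)⁻¹ ≤ 2 := by
    rw [inv_le_comm₀ (by linarith) two_pos]
    linarith
  calc ‖log (1 + w) - (w - w ^ 2 / 2)‖
    _ ≤ ‖w‖ ^ 3 * (1 - ‖w‖)⁻¹ / 3 := by
      convert norm_log_sub_logTaylor_le 2 (hw.trans_lt one_half_lt_one) using 2
      · rw [htaylor]
      · norm_num
    _ ≤ ‖w‖ ^ 3 := by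
      nlinarith [pow_nonneg (norm_nonneg w) 3]

lemma norm_div_one_sub_sub_le {𝕜 : Type*} [NormedField 𝕜] {w : 𝕜} (hw : 1 ≤ ‖1 - w‖) :
    ‖w / (1 - w) - (w + w ^ 2)‖ ≤ ‖w‖ ^ 3 := by
  have hw₀ : 1 - w ≠ 0 := norm_pos_iff.1 (one_pos.trans_le hw)
  have : w / (1 - w) - (w + w ^ 2) = w ^ 3 / (1 - w) := by
    field_simp
    ring
  rw [this, norm_div, norm_pow]
  exact div_le_self (by positivity) hw

/-- The exponent of the characteristic function of the noncentral chi-squared distribution with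
`d` degrees of freedom and noncentrality parameter `lam`, written with the principal logarithm;
real values of `d` are allowed. -/
noncomputable def chiSqCumulant (d lam t : ℝ) : ℂ :=
  lam * (t * I) / (1 - 2 * (t * I)) - d / 2 * log (1 - 2 * (t * I))

lemma one_sub_two_mul_I_mem_slitPlane (t : ℝ) : 1 - 2 * (t * I) ∈ slitPlane := by
  simp [mem_slitPlane_iff]

lemma chiSqCumulant_one_sq (m t : ℝ) :
    chiSqCumulant 1 (m ^ 2) t = -(1 / 2 * log (1 - 2 * (t * I))) +
      (t * m ^ 2 * I - (2 * t * m * I) ^ 2 / (4 * (t * I - 1 / 2))) := by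
  have hw₀ : (1 - 2 * (t * I) : ℂ) ≠ 0 := slitPlane_ne_zero (one_sub_two_mul_I_mem_slitPlane t)
  have hden : (4 * (t * I - 1 / 2) : ℂ) = -(2 * (1 - 2 * (t * I))) := by ring
  have hquot : t * m ^ 2 * I - (2 * t * m * I) ^ 2 / (4 * (t * I - 1 / 2)) =
      m ^ 2 * (t * I) / (1 - 2 * (t * I)) := by
    rw [hden, div_neg, sub_neg_eq_add, eq_div_iff hw₀, add_mul, ← div_div, div_mul_cancel₀ _ hw₀]
    ring
  rw [chiSqCumulant, hquot]
  push_cast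
  ring

theorem charFun_map_add_sq_gaussianReal (m t : ℝ) :
    charFun ((gaussianReal 0 1).map fun z => (z + m) ^ 2) t =
      cexp (chiSqCumulant 1 (m ^ 2) t) := by
  have hre : (t * I - 1 / 2 : ℂ).re < 0 := by simp
  have hb : (π / -(t * I - 1 / 2) : ℂ) = (2 * π : ℝ) * (1 - 2 * (t * I))⁻¹ := by
    have : -(t * I - 1 / 2 : ℂ) = (1 - 2 * (t * I)) / 2 := by ring
    rw [this]
    push_cast
    field_simp
  calc charFun ((gaussianReal 0 1).map fun z => (z + m) ^ 2) t
    _ = ∫ z, cexp (t * (z + m) ^ 2 * I) ∂gaussianReal 0 1 := by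
      rw [charFun_apply_real, integral_map (by fun_prop) (by fun_prop)]
      push_cast
      rfl
    _ = (√(2 * π))⁻¹ *
          ∫ z : ℝ, cexp ((t * I - 1 / 2) * z ^ 2 + 2 * t * m * I * z + t * m ^ 2 * I) := by
      rw [integral_gaussianReal_eq_integral_smul one_ne_zero, ← integral_const_mul]
      congr with z
      simp only [gaussianPDFReal, NNReal.coe_one, mul_one, sub_zero, real_smul, ofReal_mul,
        ofReal_inv, ofReal_exp, mul_assoc, ← Complex.exp_add]
      push_cast
      ring_nf
    _ = cexp (-(1 / 2 * log (1 - 2 * (t * I)))) *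
          cexp (t * m ^ 2 * I - (2 * t * m * I) ^ 2 / (4 * (t * I - 1 / 2))) := by
      rw [integral_cexp_quadratic hre, ← mul_assoc, hb,
        inv_sqrt_mul_cpow_one_half (by positivity) (one_sub_two_mul_I_mem_slitPlane t)]
    _ = cexp (chiSqCumulant 1 (m ^ 2) t) := by
      rw [chiSqCumulant_one_sq, Complex.exp_add]

theorem charFun_map_sum_add_sq {d : ℕ} (m : Fin d → ℝ) (t : ℝ) :
    charFun ((stdNormalVec d).map fun z => ∑ i, (z i + m i) ^ 2) t =
      cexp (chiSqCumulant d (∑ i, m i ^ 2) t) := by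
  have hindep : iIndepFun (fun i (z : Fin d → ℝ) => (z i + m i) ^ 2) (stdNormalVec d) :=
    iIndepFun_pi (X := fun i x => (x + m i) ^ 2) fun i => by fun_prop
  have hmarginal (i : Fin d) : (stdNormalVec d).map (fun z => (z i + m i) ^ 2) =
      (gaussianReal 0 1).map fun x => (x + m i) ^ 2 := by
    rw [← (measurePreserving_eval (fun _ : Fin d => gaussianReal 0 1) i).map_eq,
      Measure.map_map (by fun_prop) (by fun_prop)]
    rfl
  rw [hindep.charFun_map_fun_sum_eq_prod fun i => Measurable.aemeasurable (by fun_prop)]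
  simp only [Finset.prod_apply, hmarginal, charFun_map_add_sq_gaussianReal, ← Complex.exp_sum]
  congr 1
  simp [chiSqCumulant, Finset.sum_sub_distrib, Finset.sum_mul, div_eq_mul_inv, mul_assoc]

theorem charFun_noncentralChiSq {d : ℕ} {lam : ℝ} (hd : d ≠ 0) (hlam : 0 ≤ lam) (t : ℝ) :
    charFun (noncentralChiSq d lam) t = cexp (chiSqCumulant d lam t) := by
  rw [noncentralChiSq, charFun_map_sum_add_sq]
  congr 2
  rw [Fin.sum_const, Real.sq_sqrt (by positivity), nsmul_eq_mul]
  field_simp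

theorem norm_chiSqCumulant_sub_le {d lam t : ℝ} (hd : 0 ≤ d) (hlam : 0 ≤ lam) (ht : |t| ≤ 1 / 4) :
    ‖chiSqCumulant d lam t - ((d + lam) * (t * I) - (d + 2 * lam) * t ^ 2)‖ ≤
      4 * (d + lam) * |t| ^ 3 := by
  set w : ℂ := 2 * (t * I) with hw
  have hw_norm : ‖w‖ = 2 * |t| := by simp [hw]
  have hw_sq : w ^ 2 = -(4 * t ^ 2) := by
    rw [hw, mul_pow, mul_pow, I_sq]
    ring
  have hone_le : 1 ≤ ‖1 - w‖ := by
    simpa [hw] using abs_re_le_norm (1 - w)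
  have hlog : ‖log (1 - w) - (-w - w ^ 2 / 2)‖ ≤ ‖w‖ ^ 3 := by
    simpa [sub_eq_add_neg] using norm_log_one_add_sub_le (w := -w) (by rw [norm_neg]; linarith)
  have hsplit : chiSqCumulant d lam t - ((d + lam) * (t * I) - (d + 2 * lam) * t ^ 2) =
      (lam / 2 : ℝ) * (w / (1 - w) - (w + w ^ 2)) -
        (d / 2 : ℝ) * (log (1 - w) - (-w - w ^ 2 / 2)) := by
    have ht_w : t * I = w / 2 := by rw [hw]; ring
    rw [chiSqCumulant, ← hw, ht_w, hw_sq]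
    push_cast
    ring
  calc _ = _ := congrArg norm hsplit
    _ ≤ lam / 2 * ‖w‖ ^ 3 + d / 2 * ‖w‖ ^ 3 := by
      refine (norm_sub_le _ _).trans (add_le_add ?_ ?_)
      · rw [norm_mul, Complex.norm_of_nonneg (by positivity)]
        gcongr
        exact norm_div_one_sub_sub_le hone_le
      · rw [norm_mul, Complex.norm_of_nonneg (by positivity)]
        gcongr
    _ = 4 * (d + lam) * |t| ^ 3 := by
      rw [hw_norm]
      ring

lemma norm_chiSqCumulant_div_sqrt_sub_le {d lam t : ℝ} (hd : 0 ≤ d) (hlam : 0 ≤ lam)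
    (hpos : 0 < 2 * d + 4 * lam) (ht : 4 * |t| ≤ √(2 * d + 4 * lam)) :
    ‖chiSqCumulant d lam (t / √(2 * d + 4 * lam)) -
        (d + lam) * ((t / √(2 * d + 4 * lam) : ℝ) * I) - (-t ^ 2 / 2)‖ ≤
      2 * |t| ^ 3 / √(2 * d + 4 * lam) := by
  set σ := √(2 * d + 4 * lam)
  have hσ_pos : 0 < σ := Real.sqrt_pos.2 hpos
  have hσ_sq : σ ^ 2 = 2 * d + 4 * lam := Real.sq_sqrt hpos.le
  have habs : |t / σ| = |t| / σ := by rw [abs_div, abs_of_pos hσ_pos]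
  have hquad : ((d + 2 * lam) * (t / σ : ℝ) ^ 2 : ℂ) = t ^ 2 / 2 := by
    have : (d + 2 * lam) * (t / σ) ^ 2 = t ^ 2 / 2 := by
      rw [div_pow, mul_div_assoc', div_eq_div_iff (by positivity) two_ne_zero, hσ_sq]
      ring
    exact_mod_cast this
  calc _ = ‖chiSqCumulant d lam (t / σ) -
        ((d + lam) * ((t / σ : ℝ) * I) - (d + 2 * lam) * (t / σ : ℝ) ^ 2)‖ := by
        rw [hquad]
        ring_nf
    _ ≤ 4 * (d + lam) * |t / σ| ^ 3 :=
      norm_chiSqCumulant_sub_le hd hlam (by rw [habs, div_le_iff₀ hσ_pos]; linarith)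
    _ ≤ 2 * σ ^ 2 * |t / σ| ^ 3 :=
      mul_le_mul_of_nonneg_right (by linarith) (by positivity)
    _ = 2 * |t| ^ 3 / σ := by
      rw [habs]
      field_simp

end CharacteristicFunction

/-! ### Normal approximation -/

theorem charFun_map_sub_div (P : Measure ℝ) (c s t : ℝ) :
    charFun (P.map fun x => (x - c) / s) t =
      charFun P (t / s) * Complex.exp (-(c * ((t / s : ℝ) * Complex.I))) := by
  rw [charFun_apply_real, charFun_apply_real, integral_map (by fun_prop) (by fun_prop),
    ← integral_mul_const]
  congr with x
  rw [← Complex.exp_add]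
  push_cast
  ring_nf

/-- The noncentral chi-squared distribution, standardized by its mean `d + lam` and its variance
`2 * d + 4 * lam`. -/
noncomputable def stdNoncentralChiSq (d : ℕ) (lam : ℝ) : Measure ℝ :=
  (noncentralChiSq d lam).map fun x => (x - (d + lam)) / √(2 * d + 4 * lam)

instance (d : ℕ) (lam : ℝ) : IsProbabilityMeasure (stdNoncentralChiSq d lam) :=
  Measure.isProbabilityMeasure_map (Measurable.aemeasurable (by fun_prop))

theorem quantile_stdNoncentralChiSq_zero {d : ℕ} (hd : d ≠ 0) {p : ℝ} (h0 : 0 < p) (h1 : p < 1) :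
    quantile (stdNoncentralChiSq d 0) p = (quantile (centralChiSq d) p - d) / √(2 * d) := by
  rw [stdNoncentralChiSq, quantile_map_sub_div _ _ (by positivity) h0 h1, noncentralChiSq_zero]
  simp

section NormalApproximation

variable {ι : Type*} {l : Filter ι} {d : ι → ℕ} {lam : ι → ℝ}

open Complex in
theorem tendsto_charFun_stdNoncentralChiSq (hd : ∀ᶠ i in l, d i ≠ 0) (hlam : ∀ i, 0 ≤ lam i)
    (hvar : Tendsto (fun i => 2 * (d i : ℝ) + 4 * lam i) l atTop) (t : ℝ) :
    Tendsto (fun i => charFun (stdNoncentralChiSq (d i) (lam i)) t) l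
      (𝓝 (charFun (gaussianReal 0 1) t)) := by
  have hσ : Tendsto (fun i => √(2 * (d i : ℝ) + 4 * lam i)) l atTop :=
    Real.tendsto_sqrt_atTop.comp hvar
  have hexponent : Tendsto (fun i => chiSqCumulant (d i) (lam i) (t / √(2 * d i + 4 * lam i)) -
      (d i + lam i) * ((t / √(2 * d i + 4 * lam i) : ℝ) * I)) l (𝓝 (-t ^ 2 / 2)) := by
    refine tendsto_iff_norm_sub_tendsto_zero.2 (squeeze_zero' (Eventually.of_forall fun _ =>
      norm_nonneg _) ?_ (tendsto_const_nhds.div_atTop (a := 2 * |t| ^ 3) hσ))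
    filter_upwards [hvar.eventually_gt_atTop 0, hσ.eventually_ge_atTop (4 * |t|)] with i hpos ht
    exact_mod_cast norm_chiSqCumulant_div_sqrt_sub_le (d i).cast_nonneg (hlam i) hpos ht
  have hgaussian : charFun (gaussianReal 0 1) t = cexp (-t ^ 2 / 2) := by
    rw [charFun_gaussianReal]
    simp [neg_div]
  rw [hgaussian]
  refine ((continuous_exp.tendsto _).comp hexponent).congr' ?_
  filter_upwards [hd] with i hi
  rw [stdNoncentralChiSq, charFun_map_sub_div, charFun_noncentralChiSq hi (hlam i), ← exp_add,
    Function.comp_apply, sub_eq_add_neg]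
  push_cast
  rfl

instance : NullSingletonClass (gaussianReal 0 1) := nullSingletonClass_gaussianReal one_ne_zero

theorem strictMono_stdNormalCDF : StrictMono stdNormalCDF := by
  have := (gaussianReal_absolutelyContinuous' 0 one_ne_zero).isOpenPosMeasure
  exact strictMono_cdf (gaussianReal 0 1)

theorem tendsto_cdf_stdNoncentralChiSq [l.IsCountablyGenerated] (hd : ∀ᶠ i in l, d i ≠ 0)
    (hlam : ∀ i, 0 ≤ lam i) (hvar : Tendsto (fun i => 2 * (d i : ℝ) + 4 * lam i) l atTop)
    (x : ℝ) : Tendsto (fun i => cdf (stdNoncentralChiSq (d i) (lam i)) x) l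
      (𝓝 (stdNormalCDF x)) :=
  tendsto_cdf_of_tendsto_charFun (tendsto_charFun_stdNoncentralChiSq hd hlam hvar) x

theorem tendsto_cdf_noncentralChiSq_sub [l.IsCountablyGenerated] (hd : ∀ᶠ i in l, d i ≠ 0)
    (hlam : ∀ i, 0 ≤ lam i) (hvar : Tendsto (fun i => 2 * (d i : ℝ) + 4 * lam i) l atTop)
    (x : ι → ℝ) :
    Tendsto (fun i => cdf (noncentralChiSq (d i) (lam i)) (x i) -
      stdNormalCDF ((x i - d i - lam i) / √(2 * d i + 4 * lam i))) l (𝓝 0) := by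
  have hunif : TendstoUniformly (fun i => cdf (stdNoncentralChiSq (d i) (lam i))) stdNormalCDF l :=
    tendstoUniformly_cdf (tendsto_cdf_stdNoncentralChiSq hd hlam hvar)
  refine Metric.tendsto_nhds.2 fun ε hε => ?_
  filter_upwards [Metric.tendstoUniformly_iff.1 hunif ε hε, hvar.eventually_gt_atTop 0]
    with i hi hpos
  rw [← cdf_map_sub_div _ (d i + lam i) (Real.sqrt_pos.2 hpos), sub_sub, dist_zero_right,
    ← dist_eq_norm']
  exact hi _

theorem tendsto_quantile_centralChiSq {p : ℝ} (h0 : 0 < p) (h1 : p < 1) :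
    Tendsto (fun d : ℕ => (quantile (centralChiSq d) p - d) / √(2 * d)) atTop
      (𝓝 (quantile (gaussianReal 0 1) p)) := by
  have hd : ∀ᶠ d : ℕ in atTop, d ≠ 0 := eventually_ne_atTop 0
  have hvar : Tendsto (fun d : ℕ => 2 * (d : ℝ) + 4 * 0) atTop atTop := by
    simpa using tendsto_natCast_atTop_atTop.const_mul_atTop two_pos
  refine (tendsto_quantile strictMono_stdNormalCDF
    (tendsto_cdf_stdNoncentralChiSq hd (fun _ => le_rfl) hvar) h0 h1).congr' ?_
  filter_upwards [hd] with d hd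
  exact quantile_stdNoncentralChiSq_zero hd h0 h1

theorem tendsto_variance_atTop (hd : Tendsto d l atTop) (hlam : ∀ i, 0 ≤ lam i) :
    Tendsto (fun i => 2 * (d i : ℝ) + 4 * lam i) l atTop :=
  ((tendsto_natCast_atTop_atTop.comp hd).const_mul_atTop two_pos).atTop_add_nonneg
    fun i => mul_nonneg zero_le_four (hlam i)

theorem tendsto_cdf_noncentralChiSq_quantile_sub [l.IsCountablyGenerated]
    (hd : Tendsto d l atTop) (hlam : ∀ i, 0 ≤ lam i) {p : ℝ} (h0 : 0 < p) (h1 : p < 1) :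
    Tendsto (fun i => cdf (noncentralChiSq (d i) (lam i)) (quantile (centralChiSq (d i)) p) -
      stdNormalCDF (√(2 * d i) / √(2 * d i + 4 * lam i) * quantile (gaussianReal 0 1) p -
        lam i / √(2 * d i + 4 * lam i))) l (𝓝 0) := by
  set z := quantile (gaussianReal 0 1) p
  let σ (i : ι) : ℝ := √(2 * d i + 4 * lam i)
  let T (i : ι) : ℝ := quantile (centralChiSq (d i)) p
  have hvar := tendsto_variance_atTop hd hlam
  have hargs : Tendsto (fun i => (T i - d i - lam i) / σ i -
      (√(2 * d i) / σ i * z - lam i / σ i)) l (𝓝 0) := by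
    refine squeeze_zero_norm' ?_ (tendsto_iff_norm_sub_tendsto_zero.1
      ((tendsto_quantile_centralChiSq h0 h1).comp hd))
    filter_upwards [hd.eventually_ne_atTop 0] with i hi
    have hsqrt_le : √(2 * d i) ≤ σ i := Real.sqrt_le_sqrt (by linarith [hlam i])
    have hsqrt_pos : 0 < √(2 * d i : ℝ) := by positivity
    have hfactor : (T i - d i - lam i) / σ i - (√(2 * d i) / σ i * z - lam i / σ i) =
        √(2 * d i) / σ i * ((T i - d i) / √(2 * d i) - z) := by
      have := hsqrt_pos.trans_le hsqrt_le
      field_simp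
      ring
    rw [hfactor, norm_mul]
    refine mul_le_of_le_one_left (norm_nonneg _) ?_
    rw [Real.norm_of_nonneg (by positivity)]
    exact div_le_one_of_le₀ hsqrt_le (by positivity)
  have hΦ : Tendsto (fun i => stdNormalCDF ((T i - d i - lam i) / σ i) -
      stdNormalCDF (√(2 * d i) / σ i * z - lam i / σ i)) l (𝓝 0) :=
    tendsto_comp_sub_comp (uniformContinuous_cdf (gaussianReal 0 1)) hargs
  have hsum := (tendsto_cdf_noncentralChiSq_sub (hd.eventually_ne_atTop 0) hlam hvar T).add hΦ
  rw [add_zero] at hsum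
  exact hsum.congr fun i => sub_add_sub_cancel _ _ _

end NormalApproximation

theorem mainTheorem4 :
    TendstoUniformly
      (fun (d : ℕ) (x : ℝ) =>
        cdf (centralChiSq d) x - stdNormalCDF ((x - d) / √(2 * d)))
      (fun _ => 0) atTop ∧
    TendstoUniformly
      (fun (d : ℕ) (q : ℝ × ℝ) =>
        cdf (noncentralChiSq d (q.2 ^ 2)) q.1
          - stdNormalCDF ((q.1 - d - q.2 ^ 2) / √(2 * d + 4 * q.2 ^ 2)))
      (fun _ => 0) atTop ∧
    ∀ α : ℝ, 0 < α → α < 1 →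
      TendstoUniformly
        (fun (d : ℕ) (r : ℝ) =>
          cdf (noncentralChiSq d (r ^ 2)) (quantile (centralChiSq d) (1 - α))
            - stdNormalCDF
                (√(2 * d) / √(2 * d + 4 * r ^ 2) * quantile (gaussianReal 0 1) (1 - α)
                  - r ^ 2 / √(2 * d + 4 * r ^ 2)))
        (fun _ => 0) atTop := by
  refine ⟨?central, ?noncentral, fun α h0 h1 => ?quantile⟩
  case central =>
    refine tendsto_prod_top_iff.1 ((tendsto_cdf_noncentralChiSq_sub
      (tendsto_fst.eventually_ne_atTop 0) (fun _ => le_rfl)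
      (tendsto_variance_atTop tendsto_fst fun _ => le_rfl) fun q : ℕ × ℝ => q.2).congr fun q => ?_)
    rw [noncentralChiSq_zero, mul_zero, sub_zero, add_zero]
    rfl
  case noncentral =>
    exact tendsto_prod_top_iff.1 (tendsto_cdf_noncentralChiSq_sub
      (tendsto_fst.eventually_ne_atTop 0) (fun _ => sq_nonneg _)
      (tendsto_variance_atTop tendsto_fst fun _ => sq_nonneg _) fun q : ℕ × ℝ × ℝ => q.2.1)
  case quantile =>
    exact tendsto_prod_top_iff.1 (tendsto_cdf_noncentralChiSq_quantile_sub (p := 1 - α)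
      tendsto_fst (fun _ => sq_nonneg _) (by linarith) (by linarith))
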